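/- Let $d,m\in\mathbb N$, let $L_1,\dots,L_m$ be complex $d\times d$ matrices, and let $\mathcal D(\rho)=\sum_{i=1}^m\big(L_i\rho L_i^\dagger-\tfrac12\{L_i^\dagger L_i,\rho\}\big)$. Let $H:[0,\infty)\to\mathbb C^{d\times d}$ be a differentiable (one-sidedly at $0$) function with Hermitian values, and let $\mathcal L_t=-i[H(t),\,\cdot\,]+\mathcal D$ for $t\ge 0$. For a time-dependent Lindbladian $\mathcal M_t$ write $\mathcal E^{\mathcal M}_{t,s}=\mathcal T\exp\big(\int_s^t\mathcal M_\tau\,d\tau\big)$ for its time-evolution channel (the time-ordered exponential). Let $\|\cdot\|_1$ be the trace norm and $\|\cdot\|_\infty$ the operator norm. Call $\mathcal M_t$ exponentially contractive with constants $K,\gamma>0$ if $$\|\mathcal E^{\mathcal M}_{t,s}(\rho-\sigma)\|_1\le K e^{-\gamma|t-s|}\,\|\rho-\sigma\|_1$$ for all density matrices $\rho,\sigma$ (positive semidefinite with trace one) and all $t\ge s\ge 0$, and exponentially contractive if such $K,\gamma>0$ exist. Suppose there are $K_0,\gamma_0>0$ such that for every $t_0\ge 0$ the constant Lindbladian $\mathcal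 L_{t_0}=-i[H(t_0),\,\cdot\,]+\mathcal D$ is exponentially contractive with constants $K_0,\gamma_0$. If $$\sup_{t\ge 0}\Big\|\frac{d}{dt}H(t)\Big\|_\infty<\frac{2\gamma_0^2}{3}\cdot\frac{1}{1+\frac23\ln K_0+\frac13(\ln K_0)^2},$$ then the time-dependent Lindbladian $\mathcal L_t$ is exponentially contractive. -/

import Mathlib

open scoped Matrix ComplexOrder Matrix.Norms.L2Operator

noncomputable section

namespace DrivenLindblad

/-- Operators on the Hilbert space `ℂ^d`. With the opened scope, `‖X‖` is the operator norm of `X`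
on `EuclideanSpace ℂ (Fin d)`, that is, the Schatten norm with index infinity. -/
abbrev Op (d : ℕ) : Type := Matrix (Fin d) (Fin d) ℂ

/-- Density operators: positive semidefinite with trace one. -/
def IsState {d : ℕ} (ρ : Op d) : Prop :=
  ρ.PosSemidef ∧ ρ.trace = 1

/-- The trace norm (Schatten norm with index one): the sum of the singular values. -/
def traceNorm {d : ℕ} (X : Op d) : ℝ :=
  ∑ i ∈ Finset.range d, (Matrix.toEuclideanLin X).singularValues i

/-- The Hamiltonian part `ρ ↦ -i[H, ρ]`. -/
def hamiltonianPart {d : ℕ} (H : Op d) : Op d →ₗ[ℂ] Op d where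
  toFun ρ := (-Complex.I) • (H * ρ - ρ * H)
  map_add' ρ σ := by rw [mul_add, add_mul, ← smul_add]; congr 1; abel
  map_smul' c ρ := by
    rw [Matrix.mul_smul, Matrix.smul_mul, ← smul_sub, smul_comm, RingHom.id_apply]

/-- The dissipator `ρ ↦ L ρ L† - {L†L, ρ} / 2` of a single jump operator. -/
def dissipator {d : ℕ} (L : Op d) : Op d →ₗ[ℂ] Op d where
  toFun ρ := L * ρ * Lᴴ - (1 / 2 : ℂ) • (Lᴴ * L * ρ + ρ * (Lᴴ * L))
  map_add' ρ σ := by simp only [mul_add, add_mul, smul_add]; abel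
  map_smul' c ρ := by
    simp only [Matrix.mul_smul, Matrix.smul_mul, RingHom.id_apply, ← smul_add, smul_sub]
    rw [smul_comm]

/-- The Lindbladian with Hamiltonian `H` and jump operators `L 0, …, L (m - 1)`. -/
def lindbladian {d m : ℕ} (L : Fin m → Op d) (H : Op d) : Op d →ₗ[ℂ] Op d :=
  hamiltonianPart H + ∑ i, dissipator (L i)

/-- The `n`-th term of the time-ordered exponential applied to `ρ`: the integral of
`𝓛 τ_n (⋯ (𝓛 τ_1 ρ))` over the simplex `s ≤ τ_1 ≤ ⋯ ≤ τ_n ≤ t`, as an iterated integral. -/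
def dysonTerm {d : ℕ} (𝓛 : ℝ → Op d →ₗ[ℂ] Op d) (s : ℝ) (ρ : Op d) : ℕ → ℝ → Op d
  | 0, _ => ρ
  | n + 1, t => ∫ τ in s..t, 𝓛 τ (dysonTerm 𝓛 s ρ n τ)

/-- The time-evolution channel from time `s` to time `t`, that is, the time-ordered exponential of
`∫ τ in s..t, 𝓛 τ`, given by its (Dyson) series. -/
def evolution {d : ℕ} (𝓛 : ℝ → Op d →ₗ[ℂ] Op d) (t s : ℝ) (ρ : Op d) : Op d :=
  ∑' n, dysonTerm 𝓛 s ρ n t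

/-- The time-dependent Lindbladian `𝓛` is exponentially contractive with constant `K` and
rate (at least) `γ`. -/
def IsContractiveWith {d : ℕ} (𝓛 : ℝ → Op d →ₗ[ℂ] Op d) (K γ : ℝ) : Prop :=
  ∀ ρ σ : Op d, IsState ρ → IsState σ → ∀ s t : ℝ, 0 ≤ s → s ≤ t →
    traceNorm (evolution 𝓛 t s (ρ - σ)) ≤ K * Real.exp (-γ * |t - s|) * traceNorm (ρ - σ)

/-- The time-dependent Lindbladian `𝓛` is exponentially contractive. -/
def IsExponentiallyContractive {d : ℕ} (𝓛 : ℝ → Op d →ₗ[ℂ] Op d) : Prop :=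
  ∃ K γ : ℝ, 0 < K ∧ 0 < γ ∧ IsContractiveWith 𝓛 K γ

end DrivenLindblad

end

noncomputable section

namespace DrivenLindblad

open Matrix Filter Topology

/-! Over a window starting at `p`, the driven solution `X` is compared with the solution `Y` from
the same initial value whose Hamiltonian is frozen at the intermediate time `p + a`. The difference
satisfies a Lindblad equation with forcing `-i[H t - H (p + a), Y t]`. Lindblad flows do not
increase the trace norm, so the deviation is at most the time integral of `2‖H t - H (p + a)‖ ‖Y
t‖₁`.

With `c` a Lipschitz constant of `H`, `l = log K`, `u = t - p` and the frozen bound `‖Y t‖₁ ≤ min(1,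
K e^{-γu}) ‖X p‖₁`, this integral is at most `2c ∫ |u - a| min(1, K e^{-γu}) du` times `‖X p‖₁`. The
weight has total mass `(l + 1)/γ`; half of it, `a = (l + 1)/(2γ)`, is the median of the weight when
`l ≥ 1`. This choice gives the bound `θ = c(l² + 2l + 3)/(2γ²)`, and the slowness hypothesis says
exactly `θ < 1`.

Hence a window of length `T` contracts by `q = K e^{-γT} + θ`, which is below one for large `T`
because `θ` does not depend on `T`. Iterating, and using monotonicity inside an incomplete window,
gives exponential decay. The quantitative core is `traceNorm_le_of_hasDerivWithinAt` and
`traceNorm_sub_le_of_lipschitz`; `hasDerivAt_evolution` links the Dyson series to the differential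
equation. -/

/-! ### Trace norm and its duality with the operator norm. -/

theorem inner_toEuclideanCLM_conjTranspose {d : ℕ} (A : Op d) (x y : EuclideanSpace ℂ (Fin d)) :
    inner ℂ x (toEuclideanCLM (𝕜 := ℂ) Aᴴ y) = inner ℂ (toEuclideanCLM (𝕜 := ℂ) A x) y := by
  rw [← star_eq_conjTranspose, map_star, ContinuousLinearMap.star_eq_adjoint,
    ContinuousLinearMap.adjoint_inner_right]

theorem trace_eq_sum_inner {d : ℕ} {ι : Type*} [Fintype ι] (A : Op d)
    (b : OrthonormalBasis ι ℂ (EuclideanSpace ℂ (Fin d))) :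
    A.trace = ∑ i, inner ℂ (b i) (toEuclideanCLM (𝕜 := ℂ) A (b i)) := by
  have h : A.trace = LinearMap.trace ℂ _ (toEuclideanLin A) := by
    rw [toEuclideanLin_eq_toLin_orthonormal, trace_toLin_eq]
  exact h.trans (LinearMap.trace_eq_sum_inner _ b)

/-- Singular value decomposition: an orthonormal basis whose image is an orthogonal family with
the singular values as lengths. -/
theorem exists_singular_basis {d : ℕ} (X : Op d) :
    ∃ b : OrthonormalBasis (Fin d) ℂ (EuclideanSpace ℂ (Fin d)), ∃ σ : Fin d → ℝ,
      (∀ i, 0 ≤ σ i) ∧ traceNorm X = ∑ i, σ i ∧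
      ∀ i j, inner ℂ (toEuclideanCLM (𝕜 := ℂ) X (b i)) (toEuclideanCLM (𝕜 := ℂ) X (b j)) =
        if i = j then ((σ i : ℂ) ^ 2) else 0 := by
  set T := toEuclideanLin X with hT
  have hn : Module.finrank ℂ (EuclideanSpace ℂ (Fin d)) = d := finrank_euclideanSpace_fin
  refine ⟨T.isSymmetric_adjoint_comp_self.eigenvectorBasis hn, fun i => T.singularValues i,
    fun i => T.singularValues_nonneg i, ?_, fun i j => ?_⟩
  · rw [traceNorm, Finset.sum_range]
  · set b := T.isSymmetric_adjoint_comp_self.eigenvectorBasis hn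
    have h := T.isSymmetric_adjoint_comp_self.apply_eigenvectorBasis hn j
    change inner ℂ (T (b i)) (T (b j)) = _
    rw [← LinearMap.adjoint_inner_right]
    change inner ℂ (b i) ((LinearMap.adjoint T ∘ₗ T) (b j)) = _
    rw [h, ← T.sq_singularValues_fin hn j, inner_smul_right, OrthonormalBasis.inner_eq_ite]
    split_ifs with hij
    · subst hij; push_cast; simp
    · simp

theorem traceNorm_nonneg {d : ℕ} (X : Op d) : 0 ≤ traceNorm X :=
  Finset.sum_nonneg fun i _ => LinearMap.singularValues_nonneg _ i

theorem norm_trace_mul_le {d : ℕ} (A X : Op d) : ‖(A * X).trace‖ ≤ ‖A‖ * traceNorm X := by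
  obtain ⟨b, σ, hσ, hsum, hb⟩ := exists_singular_basis X
  rw [trace_eq_sum_inner _ b, hsum, Finset.mul_sum]
  refine (norm_sum_le _ _).trans (Finset.sum_le_sum fun i _ => ?_)
  refine (norm_inner_le_norm _ _).trans ?_
  rw [b.norm_eq_one, one_mul, map_mul]
  refine (ContinuousLinearMap.le_opNorm (toEuclideanCLM (𝕜 := ℂ) A) _).trans ?_
  rw [l2_opNorm_toEuclideanCLM]
  refine mul_le_mul_of_nonneg_left (le_of_eq ?_) (norm_nonneg _)
  have h := hb i i
  rw [if_pos rfl, inner_self_eq_norm_sq_to_K] at h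
  exact (sq_eq_sq₀ (norm_nonneg _) (hσ i)).1 (Complex.ofReal_injective (by push_cast; exact h))

/-- The witness is the adjoint of the partial isometry in the polar decomposition: it sends `X bᵢ /
σᵢ` back to `bᵢ` for the nonzero singular values and kills the orthogonal complement. Bessel's
inequality bounds its norm by one. -/
theorem exists_trace_mul_eq_traceNorm {d : ℕ} (X : Op d) :
    ∃ A : Op d, ‖A‖ ≤ 1 ∧ (A * X).trace = traceNorm X := by
  obtain ⟨b, σ, hσ, hsum, hb⟩ := exists_singular_basis X
  set T := toEuclideanCLM (𝕜 := ℂ) X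
  let u : {i : Fin d // σ i ≠ 0} → EuclideanSpace ℂ (Fin d) :=
    fun i => ((σ i : ℂ)⁻¹) • T (b i)
  have hu : Orthonormal ℂ u := by
    rw [orthonormal_iff_ite]
    rintro ⟨i, hi⟩ ⟨j, hj⟩
    simp only [u, inner_smul_left, inner_smul_right, hb, Subtype.mk.injEq]
    split_ifs with h
    · subst h
      have : (σ i : ℂ) ≠ 0 := by exact_mod_cast hi
      simp only [map_inv₀, Complex.conj_ofReal]
      field_simp
    · simp
  let S : EuclideanSpace ℂ (Fin d) →L[ℂ] EuclideanSpace ℂ (Fin d) :=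
    ∑ i : {i : Fin d // σ i ≠ 0}, (innerSL ℂ (u i)).smulRight (b i)
  have hS : ∀ y, S y = ∑ i : {i : Fin d // σ i ≠ 0}, inner ℂ (u i) y • b i := fun y => by
    simp [S]
  have hSnorm : ‖S‖ ≤ 1 := by
    refine ContinuousLinearMap.opNorm_le_bound _ zero_le_one fun y => ?_
    rw [one_mul, ← sq_le_sq₀ (norm_nonneg _) (norm_nonneg _), hS]
    have hv : Orthonormal ℂ (fun i : {i : Fin d // σ i ≠ 0} => b i) :=
      b.orthonormal.comp _ Subtype.val_injective
    have h2 : ‖∑ i : {i : Fin d // σ i ≠ 0}, inner ℂ (u i) y • b i‖ ^ 2 =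
        ∑ i, ‖inner ℂ (u i) y‖ ^ 2 := by
      have h3 := hv.inner_sum (fun i => inner ℂ (u i) y) (fun i => inner ℂ (u i) y) Finset.univ
      rw [inner_self_eq_norm_sq_to_K] at h3
      simp only [Complex.conj_mul'] at h3
      exact Complex.ofReal_injective (by push_cast; exact h3)
    rw [h2]
    exact hu.sum_inner_products_le y
  refine ⟨(toEuclideanCLM (𝕜 := ℂ)).symm S, ?_, ?_⟩
  · rw [← l2_opNorm_toEuclideanCLM]; simpa using hSnorm
  · rw [trace_eq_sum_inner _ b, hsum]
    push_cast
    refine Finset.sum_congr rfl fun j _ => ?_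
    rw [map_mul, StarAlgEquiv.apply_symm_apply]
    change inner ℂ (b j) (S (T (b j))) = _
    rw [hS, inner_sum]
    simp only [inner_smul_right, OrthonormalBasis.inner_eq_ite, u, inner_smul_left, hb]
    by_cases hj : σ j = 0
    · rw [hj]
      refine Finset.sum_eq_zero fun i _ => ?_
      have : (j : Fin d) ≠ i := fun h => i.2 (h ▸ hj)
      simp [this]
    · rw [Finset.sum_eq_single ⟨j, hj⟩]
      · have : (σ j : ℂ) ≠ 0 := by exact_mod_cast hj
        simp only [map_inv₀, Complex.conj_ofReal, if_true]
        field_simp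
      · intro i _ hi
        have : j ≠ (i : Fin d) := fun h => hi (Subtype.ext h.symm)
        simp [this]
      · simp

theorem traceNorm_le_of_forall {d : ℕ} {X : Op d} {C : ℝ}
    (h : ∀ A : Op d, ‖A‖ ≤ 1 → ‖(A * X).trace‖ ≤ C) : traceNorm X ≤ C := by
  obtain ⟨A, hA, hAX⟩ := exists_trace_mul_eq_traceNorm X
  have := h A hA
  rwa [hAX, Complex.norm_real, Real.norm_of_nonneg (traceNorm_nonneg X)] at this

theorem norm_trace_mul_le_of_norm_le_one {d : ℕ} {A : Op d} (hA : ‖A‖ ≤ 1) (X : Op d) :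
    ‖(A * X).trace‖ ≤ traceNorm X :=
  (norm_trace_mul_le A X).trans (mul_le_of_le_one_left (traceNorm_nonneg X) hA)

theorem traceNorm_add_le {d : ℕ} (X Y : Op d) : traceNorm (X + Y) ≤ traceNorm X + traceNorm Y :=
  traceNorm_le_of_forall fun A hA => by
    rw [mul_add, trace_add]
    exact (norm_add_le _ _).trans (add_le_add (norm_trace_mul_le_of_norm_le_one hA X)
      (norm_trace_mul_le_of_norm_le_one hA Y))

theorem traceNorm_smul_le {d : ℕ} (c : ℂ) (X : Op d) :
    traceNorm (c • X) ≤ ‖c‖ * traceNorm X :=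
  traceNorm_le_of_forall fun A hA => by
    rw [Matrix.mul_smul, trace_smul, norm_smul]
    exact mul_le_mul_of_nonneg_left (norm_trace_mul_le_of_norm_le_one hA X) (norm_nonneg _)

theorem traceNorm_smul {d : ℕ} (c : ℂ) (X : Op d) : traceNorm (c • X) = ‖c‖ * traceNorm X := by
  refine le_antisymm (traceNorm_smul_le c X) ?_
  rcases eq_or_ne c 0 with rfl | hc
  · simpa using traceNorm_nonneg _
  have h := traceNorm_smul_le c⁻¹ (c • X)
  rw [inv_smul_smul₀ hc, norm_inv] at h
  have hc' : 0 < ‖c‖ := norm_pos_iff.2 hc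
  calc ‖c‖ * traceNorm X ≤ ‖c‖ * (‖c‖⁻¹ * traceNorm (c • X)) := by gcongr
    _ = _ := by field_simp

theorem traceNorm_neg {d : ℕ} (X : Op d) : traceNorm (-X) = traceNorm X := by
  simpa using traceNorm_smul (-1) X

theorem traceNorm_sub_le {d : ℕ} (X Y : Op d) :
    traceNorm (X - Y) ≤ traceNorm X + traceNorm Y := by
  rw [sub_eq_add_neg, ← traceNorm_neg Y]; exact traceNorm_add_le _ _

theorem traceNorm_mul_le_left {d : ℕ} (B X : Op d) : traceNorm (B * X) ≤ ‖B‖ * traceNorm X :=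
  traceNorm_le_of_forall fun A hA => by
    rw [← mul_assoc]
    refine (norm_trace_mul_le _ _).trans (mul_le_mul_of_nonneg_right ?_ (traceNorm_nonneg X))
    exact (norm_mul_le _ _).trans (mul_le_of_le_one_left (norm_nonneg _) hA)

theorem traceNorm_mul_le_right {d : ℕ} (B X : Op d) : traceNorm (X * B) ≤ ‖B‖ * traceNorm X :=
  traceNorm_le_of_forall fun A hA => by
    rw [← mul_assoc, trace_mul_comm, ← mul_assoc]
    refine (norm_trace_mul_le _ _).trans (mul_le_mul_of_nonneg_right ?_ (traceNorm_nonneg X))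
    exact (norm_mul_le _ _).trans (mul_le_of_le_one_right (norm_nonneg _) hA)

theorem traceNorm_le_traceNorm_one_mul {d : ℕ} (X : Op d) :
    traceNorm X ≤ traceNorm (1 : Op d) * ‖X‖ := by
  simpa [mul_comm] using traceNorm_mul_le_left X 1

theorem eq_zero_of_traceNorm_eq_zero {d : ℕ} {X : Op d} (h : traceNorm X = 0) : X = 0 := by
  have h1 := norm_trace_mul_le Xᴴ X
  rw [h, mul_zero, norm_le_zero_iff] at h1
  exact trace_conjTranspose_mul_self_eq_zero_iff.1 h1

theorem traceNorm_zero {d : ℕ} : traceNorm (0 : Op d) = 0 := by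
  simpa using traceNorm_smul (0 : ℂ) (0 : Op d)

/-! ### Norm bounds for Kraus-type maps. -/

theorem sum_mul_le_of_sum_sq_le {ι : Type*} [Fintype ι] {p q : ι → ℝ} {κ a b : ℝ} (hκ : 0 ≤ κ)
    (ha : 0 ≤ a) (hb : 0 ≤ b) (hp : ∑ i, p i ^ 2 ≤ κ * a ^ 2) (hq : ∑ i, q i ^ 2 ≤ κ * b ^ 2) :
    ∑ i, p i * q i ≤ κ * (a * b) := by
  refine (abs_le_of_sq_le_sq' ?_ (by positivity)).2
  calc (∑ i, p i * q i) ^ 2 ≤ (∑ i, p i ^ 2) * ∑ i, q i ^ 2 :=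
        Finset.sum_mul_sq_le_sq_mul_sq _ _ _
    _ ≤ (κ * a ^ 2) * (κ * b ^ 2) :=
        mul_le_mul hp hq (Finset.sum_nonneg fun i _ => sq_nonneg _) (by positivity)
    _ = _ := by ring

theorem sum_norm_sq_apply_le {d : ℕ} {ι : Type*} [Fintype ι] (V : ι → Op d)
    (x : EuclideanSpace ℂ (Fin d)) :
    ∑ i, ‖toEuclideanCLM (𝕜 := ℂ) (V i) x‖ ^ 2 ≤ ‖∑ i, (V i)ᴴ * V i‖ * ‖x‖ ^ 2 := by
  have h : ((∑ i, ‖toEuclideanCLM (𝕜 := ℂ) (V i) x‖ ^ 2 : ℝ) : ℂ) =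
      inner ℂ x (toEuclideanCLM (𝕜 := ℂ) (∑ i, (V i)ᴴ * V i) x) := by
    rw [map_sum, _root_.sum_apply, inner_sum]
    push_cast
    refine Finset.sum_congr rfl fun i _ => ?_
    rw [map_mul, mul_apply_eq_comp, inner_toEuclideanCLM_conjTranspose, inner_self_eq_norm_sq_to_K]
    rfl
  have h2 : ∑ i, ‖toEuclideanCLM (𝕜 := ℂ) (V i) x‖ ^ 2 ≤
      ‖inner ℂ x (toEuclideanCLM (𝕜 := ℂ) (∑ i, (V i)ᴴ * V i) x)‖ := by
    rw [← h, Complex.norm_real]; exact Real.le_norm_self _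
  have h3 := ContinuousLinearMap.le_opNorm (toEuclideanCLM (𝕜 := ℂ) (∑ i, (V i)ᴴ * V i)) x
  rw [l2_opNorm_toEuclideanCLM] at h3
  calc _ ≤ _ := h2
    _ ≤ ‖x‖ * ‖toEuclideanCLM (𝕜 := ℂ) (∑ i, (V i)ᴴ * V i) x‖ := norm_inner_le_norm _ _
    _ ≤ ‖x‖ * (‖∑ i, (V i)ᴴ * V i‖ * ‖x‖) := mul_le_mul_of_nonneg_left h3 (norm_nonneg _)
    _ = _ := by ring

/-- Cauchy–Schwarz over the index `i`, since `∑ ‖Vᵢ x‖²` is the quadratic form of `∑ Vᵢ† Vᵢ` at `x`.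
-/
theorem norm_inner_sum_conjTranspose_mul_mul_le {d : ℕ} {ι : Type*} [Fintype ι] (V : ι → Op d)
    (A : Op d) (x y : EuclideanSpace ℂ (Fin d)) :
    ‖inner ℂ x (toEuclideanCLM (𝕜 := ℂ) (∑ i, (V i)ᴴ * A * V i) y)‖ ≤
      ‖A‖ * (‖∑ i, (V i)ᴴ * V i‖ * (‖x‖ * ‖y‖)) := by
  rw [map_sum, _root_.sum_apply, inner_sum]
  refine (norm_sum_le _ _).trans ?_
  refine le_trans ?_ (mul_le_mul_of_nonneg_left
    (sum_mul_le_of_sum_sq_le (norm_nonneg _) (norm_nonneg _) (norm_nonneg _)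
      (sum_norm_sq_apply_le V x) (sum_norm_sq_apply_le V y)) (norm_nonneg A))
  rw [Finset.mul_sum]
  refine Finset.sum_le_sum fun i _ => ?_
  · rw [map_mul, map_mul, mul_apply_eq_comp, mul_apply_eq_comp, inner_toEuclideanCLM_conjTranspose]
    have h3 := ContinuousLinearMap.le_opNorm (toEuclideanCLM (𝕜 := ℂ) A)
      (toEuclideanCLM (𝕜 := ℂ) (V i) y)
    rw [l2_opNorm_toEuclideanCLM] at h3
    calc _ ≤ _ := norm_inner_le_norm _ _
      _ ≤ ‖toEuclideanCLM (𝕜 := ℂ) (V i) x‖ * (‖A‖ * ‖toEuclideanCLM (𝕜 := ℂ) (V i) y‖) :=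
        mul_le_mul_of_nonneg_left h3 (norm_nonneg _)
      _ = _ := by ring

theorem norm_sum_conjTranspose_mul_mul_le {d : ℕ} {ι : Type*} [Fintype ι] (V : ι → Op d)
    (A : Op d) : ‖∑ i, (V i)ᴴ * A * V i‖ ≤ ‖∑ i, (V i)ᴴ * V i‖ * ‖A‖ := by
  rw [← l2_opNorm_toEuclideanCLM]
  refine ContinuousLinearMap.opNorm_le_bound _ (by positivity) fun y => ?_
  have h := norm_inner_sum_conjTranspose_mul_mul_le V A
    (toEuclideanCLM (𝕜 := ℂ) (∑ i, (V i)ᴴ * A * V i) y) y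
  generalize toEuclideanCLM (𝕜 := ℂ) (∑ i, (V i)ᴴ * A * V i) y = x at h ⊢
  rw [inner_self_eq_norm_sq_to_K, norm_pow, RCLike.norm_ofReal, abs_norm] at h
  rcases eq_or_ne x 0 with rfl | h0
  · rw [norm_zero]; positivity
  refine le_of_mul_le_mul_right ?_ (norm_pos_iff.2 h0)
  linarith

/-- Dual to the preceding operator-norm bound: cyclicity of the trace moves the map onto the test
operator `A`. No positivity of `X` is needed. -/
theorem traceNorm_sum_mul_mul_conjTranspose_le {d : ℕ} {ι : Type*} [Fintype ι] (V : ι → Op d)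
    (X : Op d) : traceNorm (∑ i, V i * X * (V i)ᴴ) ≤ ‖∑ i, (V i)ᴴ * V i‖ * traceNorm X :=
  traceNorm_le_of_forall fun A hA => by
    have : (A * ∑ i, V i * X * (V i)ᴴ).trace = ((∑ i, (V i)ᴴ * A * V i) * X).trace := by
      rw [Finset.mul_sum, Finset.sum_mul, trace_sum, trace_sum]
      refine Finset.sum_congr rfl fun i _ => ?_
      rw [← mul_assoc, trace_mul_comm]
      simp only [mul_assoc]
    rw [this]
    refine (norm_trace_mul_le _ _).trans (mul_le_mul_of_nonneg_right ?_ (traceNorm_nonneg X))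
    exact (norm_sum_conjTranspose_mul_mul_le V A).trans
      (mul_le_of_le_one_right (norm_nonneg _) hA)

/-! ### Trace-norm growth along a forced Lindblad flow. -/

/-- The non-Hermitian effective generator `-iH - ½ ∑ L†L`. -/
def effectiveGenerator {d m : ℕ} (L : Fin m → Op d) (H : Op d) : Op d :=
  (-Complex.I) • H - (1 / 2 : ℂ) • ∑ i, (L i)ᴴ * L i

theorem conjTranspose_effectiveGenerator {d m : ℕ} (L : Fin m → Op d) {H : Op d}
    (hH : H.IsHermitian) :
    (effectiveGenerator L H)ᴴ = Complex.I • H - (1 / 2 : ℂ) • ∑ i, (L i)ᴴ * L i := by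
  simp [effectiveGenerator, conjTranspose_sub, conjTranspose_smul, hH.eq, conjTranspose_sum]

theorem lindbladian_apply {d m : ℕ} (L : Fin m → Op d) {H : Op d} (hH : H.IsHermitian)
    (X : Op d) : lindbladian L H X = effectiveGenerator L H * X + X * (effectiveGenerator L H)ᴴ +
      ∑ i, L i * X * (L i)ᴴ := by
  rw [conjTranspose_effectiveGenerator L hH]
  simp only [lindbladian, hamiltonianPart, dissipator, effectiveGenerator, LinearMap.add_apply,
    LinearMap.sum_apply, LinearMap.coe_mk, AddHom.coe_mk, Finset.sum_sub_distrib, sub_mul, mul_sub,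
    smul_mul_assoc, mul_smul_comm, Finset.sum_mul, Finset.mul_sum, ← Finset.smul_sum, smul_add,
    Finset.sum_add_distrib, smul_sub, neg_smul, neg_mul]
  abel

/-- An Euler step is a Kraus map up to second order: with Kraus operators `1 + hG` and `√h Lᵢ`, both
the excess term `h² G X G†` and the defect `∑ V†V - 1 = h² G†G` are quadratic in `h`, because `G +
G† = -∑ Lᵢ†Lᵢ`. -/
theorem traceNorm_add_smul_lindbladian_le {d m : ℕ} (L : Fin m → Op d) {H : Op d}
    (hH : H.IsHermitian) (X : Op d) {h : ℝ} (hh : 0 ≤ h) :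
    traceNorm (X + (h : ℂ) • lindbladian L H X) ≤
      (1 + h ^ 2 * (2 * ‖effectiveGenerator L H‖ ^ 2)) * traceNorm X := by
  set G := effectiveGenerator L H with hG
  let V : Option (Fin m) → Op d := fun o => o.elim (1 + (h : ℂ) • G) fun i => (√h : ℂ) • L i
  have hsq : (√h : ℂ) * (√h : ℂ) = h := by
    exact_mod_cast Real.mul_self_sqrt hh
  have hV : X + (h : ℂ) • lindbladian L H X =
      ∑ o, V o * X * (V o)ᴴ - ((h : ℂ) ^ 2) • (G * X * Gᴴ) := by
    rw [lindbladian_apply L hH, Fintype.sum_option, ← hG]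
    simp only [V, Option.elim_none, Option.elim_some, conjTranspose_add, conjTranspose_one,
      conjTranspose_smul, Complex.star_def, Complex.conj_ofReal, smul_mul_assoc, mul_smul_comm,
      smul_smul, hsq, add_mul, mul_add, one_mul, mul_one, smul_add, Finset.smul_sum, sq]
    abel
  have hVV : ∑ o, (V o)ᴴ * V o = 1 + ((h : ℂ) ^ 2) • (Gᴴ * G) := by
    have hGG : Gᴴ + G = - ∑ i, (L i)ᴴ * L i := by
      rw [hG, conjTranspose_effectiveGenerator L hH, effectiveGenerator]
      module
    rw [Fintype.sum_option]
    simp only [V, Option.elim_none, Option.elim_some, conjTranspose_add, conjTranspose_one,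
      conjTranspose_smul, Complex.star_def, Complex.conj_ofReal, smul_mul_assoc, mul_smul_comm,
      smul_smul, hsq, add_mul, mul_add, one_mul, mul_one, smul_add, ← Finset.smul_sum]
    rw [← neg_eq_iff_eq_neg.2 hGG]
    module
  have h1 : ‖(1 : Op d)‖ ≤ 1 := by
    rw [← l2_opNorm_toEuclideanCLM, map_one]
    exact ContinuousLinearMap.norm_id_le
  have hh2 : ‖(h : ℂ) ^ 2‖ = h ^ 2 := by
    rw [norm_pow, Complex.norm_real, Real.norm_of_nonneg hh]
  have hnorm : ‖∑ o, (V o)ᴴ * V o‖ ≤ 1 + h ^ 2 * ‖G‖ ^ 2 := by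
    rw [hVV]
    refine (norm_add_le _ _).trans (add_le_add h1 ?_)
    rw [norm_smul, hh2, l2_opNorm_conjTranspose_mul_self, sq ‖G‖]
  have h2 : traceNorm (((h : ℂ) ^ 2) • (G * X * Gᴴ)) ≤ h ^ 2 * ‖G‖ ^ 2 * traceNorm X := by
    rw [traceNorm_smul, hh2, mul_assoc (h ^ 2)]
    refine mul_le_mul_of_nonneg_left ?_ (sq_nonneg h)
    refine (traceNorm_mul_le_right _ _).trans ?_
    rw [l2_opNorm_conjTranspose, sq, mul_assoc]
    exact mul_le_mul_of_nonneg_left (traceNorm_mul_le_left _ _) (norm_nonneg _)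
  rw [hV]
  have h3 := traceNorm_sum_mul_mul_conjTranspose_le V X
  have h4 := mul_le_mul_of_nonneg_right hnorm (traceNorm_nonneg X)
  have h5 := traceNorm_sub_le (∑ o, V o * X * (V o)ᴴ) (((h : ℂ) ^ 2) • (G * X * Gᴴ))
  linarith

theorem continuous_traceNorm {d : ℕ} : Continuous (traceNorm : Op d → ℝ) := by
  have h1 : (0 : ℝ) ≤ traceNorm (1 : Op d) := traceNorm_nonneg _
  refine (LipschitzWith.of_le_add_mul (Real.toNNReal (traceNorm (1 : Op d)))
    fun X Y => ?_).continuous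
  rw [Real.coe_toNNReal _ h1, dist_eq_norm]
  have h2 := traceNorm_add_le Y (X - Y)
  rw [add_sub_cancel] at h2
  exact h2.trans (by gcongr; exact traceNorm_le_traceNorm_one_mul _)

/-- A differential inequality: a Lindblad flow with a forcing term increases the trace norm at most
as fast as the trace norm of the forcing. -/
theorem traceNorm_le_of_hasDerivWithinAt {d m : ℕ} (L : Fin m → Op d) {H : ℝ → Op d}
    {X R : ℝ → Op d} {B B' : ℝ → ℝ} {p q : ℝ} (hpq : p ≤ q)
    (hH : ∀ t ∈ Set.Ico p q, (H t).IsHermitian)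
    (hXc : ContinuousOn X (Set.Icc p q))
    (hX : ∀ t ∈ Set.Ico p q,
      HasDerivWithinAt X (lindbladian L (H t) (X t) + R t) (Set.Ici t) t)
    (hBc : ContinuousOn B (Set.Icc p q))
    (hB : ∀ t ∈ Set.Ico p q, HasDerivWithinAt B (B' t) (Set.Ici t) t)
    (hR : ∀ t ∈ Set.Ico p q, traceNorm (R t) ≤ B' t) :
    traceNorm (X q) ≤ traceNorm (X p) + (B q - B p) := by
  refine image_le_of_liminf_slope_right_le_deriv_boundary (a := p) (b := q)
    (f := fun t => traceNorm (X t)) (B := fun t => traceNorm (X p) + (B t - B p)) (B' := B')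
    (continuous_traceNorm.comp_continuousOn hXc) (by simp) (by fun_prop)
    (fun t ht => ((hB t ht).sub_const _).const_add _) (fun t ht r hr => ?_)
    (Set.right_mem_Icc.2 hpq)
  refine Eventually.frequently ?_
  set c := traceNorm (1 : Op d)
  set D := lindbladian L (H t) (X t) + R t
  set κ := 2 * ‖effectiveGenerator L (H t)‖ ^ 2 * traceNorm (X t)
  -- The Euler-step bound divided by `z - t` dominates the slope of the trace norm by this function
  -- of `z`: its first term is the quadratic error, its last the remainder of the derivative of `X`.
  -- Only `B' t` survives in the limit.
  have hlim : Tendsto (fun z => (z - t) * κ + B' t + c * ‖slope X t z - D‖) (𝓝[>] t)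
      (𝓝 ((t - t) * κ + B' t + c * ‖D - D‖)) := by
    have h1 : Tendsto (slope X t) (𝓝[>] t) (𝓝 D) :=
      hasDerivWithinAt_iff_tendsto_slope' (by simp) |>.1 ((hX t ht).mono Set.Ioi_subset_Ici_self)
    have h2 : Tendsto (fun z : ℝ => z) (𝓝[>] t) (𝓝 t) := nhdsWithin_le_nhds
    exact (((h2.sub_const t).mul_const κ).add_const _).add ((h1.sub_const D).norm.const_mul c)
  rw [sub_self, sub_self, norm_zero, zero_mul, mul_zero, zero_add, add_zero] at hlim
  filter_upwards [hlim.eventually_lt_const hr, self_mem_nhdsWithin] with z hz hzt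
  refine lt_of_le_of_lt ?_ hz
  have hzt' : 0 < z - t := sub_pos.2 hzt
  rw [slope_def_field, div_le_iff₀ hzt']
  have hdec : X z = (X t + ((z - t : ℝ) : ℂ) • lindbladian L (H t) (X t)) +
      ((z - t : ℝ) : ℂ) • R t + ((z - t : ℝ) : ℂ) • (slope X t z - D) := by
    have : ((z - t : ℝ) : ℂ) • slope X t z = X z - X t := by
      rw [Complex.coe_smul, sub_smul_slope, vsub_eq_sub]
    rw [smul_sub, this]
    simp only [D, smul_add]
    abel
  have hn : ‖((z - t : ℝ) : ℂ)‖ = z - t := by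
    rw [Complex.norm_real, Real.norm_of_nonneg hzt'.le]
  have h1 := traceNorm_add_smul_lindbladian_le L (hH t ht) (X t) hzt'.le
  have h2 := traceNorm_smul ((z - t : ℝ) : ℂ) (R t)
  have h3 := traceNorm_smul ((z - t : ℝ) : ℂ) (slope X t z - D)
  rw [hn] at h2 h3
  have h4 := mul_le_mul_of_nonneg_left (hR t ht) hzt'.le
  have h5 := mul_le_mul_of_nonneg_left (traceNorm_le_traceNorm_one_mul (slope X t z - D)) hzt'.le
  have h6 := traceNorm_add_le (X t + ((z - t : ℝ) : ℂ) • lindbladian L (H t) (X t))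
      (((z - t : ℝ) : ℂ) • R t)
  have h7 := traceNorm_add_le ((X t + ((z - t : ℝ) : ℂ) • lindbladian L (H t) (X t)) +
      ((z - t : ℝ) : ℂ) • R t) (((z - t : ℝ) : ℂ) • (slope X t z - D))
  rw [← hdec] at h7
  simp only [κ, c] at *
  nlinarith [h1, h2, h3, h4, h5, h6, h7]

/-! ### Solutions of the Lindblad equation: contraction, uniqueness, conserved quantities. -/

/-- `X` solves the time-dependent Lindblad equation on `[s, ∞)`. -/
def IsSolution {d m : ℕ} (L : Fin m → Op d) (H : ℝ → Op d) (s : ℝ) (X : ℝ → Op d) : Prop :=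
  ∀ t, s ≤ t → HasDerivWithinAt X (lindbladian L (H t) (X t)) (Set.Ici s) t

namespace IsSolution

variable {d m : ℕ} {L : Fin m → Op d} {H : ℝ → Op d} {s : ℝ} {X : ℝ → Op d}

theorem mono (hX : IsSolution L H s X) {p : ℝ} (hp : s ≤ p) : IsSolution L H p X :=
  fun t ht => (hX t (hp.trans ht)).mono (Set.Ici_subset_Ici.2 hp)

theorem hasDerivWithinAt_Ici (hX : IsSolution L H s X) {t : ℝ} (ht : s ≤ t) :
    HasDerivWithinAt X (lindbladian L (H t) (X t)) (Set.Ici t) t :=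
  hX.mono ht t le_rfl

theorem continuousOn (hX : IsSolution L H s X) (p q : ℝ) (hp : s ≤ p) :
    ContinuousOn X (Set.Icc p q) :=
  fun t ht => ((hX t (hp.trans ht.1)).continuousWithinAt).mono fun _ hu => hp.trans hu.1

theorem sub {Y : ℝ → Op d} (hX : IsSolution L H s X) (hY : IsSolution L H s Y) :
    IsSolution L H s (X - Y) := fun t ht => by
  simpa using (hX t ht).sub (hY t ht)

theorem smul (hX : IsSolution L H s X) (c : ℝ) : IsSolution L H s (c • X) := fun t ht => by
  have h := (hX t ht).const_smul c
  rw [← LinearMap.map_smul_of_tower] at h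
  exact h

theorem traceNorm_le (hX : IsSolution L H s X) (hH : ∀ t, s ≤ t → (H t).IsHermitian)
    {t : ℝ} (ht : s ≤ t) : traceNorm (X t) ≤ traceNorm (X s) := by
  have := traceNorm_le_of_hasDerivWithinAt L (R := 0) (B := 0) (B' := 0) ht
    (fun u hu => hH u hu.1) (hX.continuousOn s t le_rfl)
    (fun u hu => by simpa using hX.hasDerivWithinAt_Ici hu.1) continuousOn_const
    (fun u _ => hasDerivWithinAt_const _ _ _) (fun u _ => by simp [traceNorm_zero])
  simpa using this

/-- Uniqueness follows from trace-norm monotonicity applied to the difference of two solutions. -/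
theorem eq_of_eq {Y : ℝ → Op d} (hX : IsSolution L H s X) (hY : IsSolution L H s Y)
    (hH : ∀ t, s ≤ t → (H t).IsHermitian) (h : X s = Y s) {t : ℝ} (ht : s ≤ t) : X t = Y t := by
  have h1 := (hX.sub hY).traceNorm_le hH ht
  rw [Pi.sub_apply, Pi.sub_apply, h, sub_self, traceNorm_zero] at h1
  exact sub_eq_zero.1 (eq_zero_of_traceNorm_eq_zero (le_antisymm h1 (traceNorm_nonneg _)))

end IsSolution

theorem trace_lindbladian {d m : ℕ} (L : Fin m → Op d) (H X : Op d) :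
    (lindbladian L H X).trace = 0 := by
  simp only [lindbladian, hamiltonianPart, dissipator, LinearMap.add_apply, LinearMap.sum_apply,
    LinearMap.coe_mk, AddHom.coe_mk, trace_add, trace_sub, trace_smul, trace_sum]
  rw [trace_mul_comm H X, sub_self, smul_zero, zero_add]
  refine Finset.sum_eq_zero fun i _ => ?_
  rw [trace_mul_comm X, mul_assoc, trace_mul_comm (L i), mul_assoc, trace_mul_comm X,
    smul_eq_mul]
  ring

theorem conjTranspose_lindbladian {d m : ℕ} (L : Fin m → Op d) {H : Op d} (hH : H.IsHermitian)
    (X : Op d) : (lindbladian L H X)ᴴ = lindbladian L H Xᴴ := by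
  rw [lindbladian_apply L hH, lindbladian_apply L hH]
  simp only [conjTranspose_add, conjTranspose_mul, conjTranspose_conjTranspose, conjTranspose_sum,
    mul_assoc]
  abel

namespace IsSolution

variable {d m : ℕ} {L : Fin m → Op d} {H : ℝ → Op d} {s : ℝ} {X : ℝ → Op d}

theorem trace_eq (hX : IsSolution L H s X) {t : ℝ} (ht : s ≤ t) : (X t).trace = (X s).trace := by
  let φ : Op d →L[ℝ] ℂ := LinearMap.toContinuousLinearMap (traceLinearMap (Fin d) ℝ ℂ)
  refine constant_of_has_deriv_right_zero (f := fun u => φ (X u)) (a := s) (b := t)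
    (φ.continuous.comp_continuousOn (hX.continuousOn s t le_rfl)) (fun u hu => ?_) t
    (Set.right_mem_Icc.2 ht)
  have h := φ.hasFDerivAt.comp_hasDerivWithinAt u (hX.hasDerivWithinAt_Ici hu.1)
  have h0 : φ (lindbladian L (H u) (X u)) = 0 := trace_lindbladian L (H u) (X u)
  rwa [h0] at h

theorem isHermitian (hX : IsSolution L H s X) (hH : ∀ t, s ≤ t → (H t).IsHermitian)
    (h : (X s).IsHermitian) {t : ℝ} (ht : s ≤ t) : (X t).IsHermitian := by
  have hX' : IsSolution L H s (fun t => (X t)ᴴ) := fun u hu => by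
    rw [← conjTranspose_lindbladian L (hH u hu)]
    exact (hX u hu).star
  exact hX'.eq_of_eq hX hH h ht

end IsSolution

/-! ### The Dyson series solves the differential equation. -/

section Dyson

variable {d : ℕ} {𝓛 : ℝ → Op d →ₗ[ℂ] Op d} {s : ℝ}

theorem continuous_dysonTerm (hc : ∀ X : ℝ → Op d, Continuous X → Continuous fun t => 𝓛 t (X t))
    (ρ : Op d) (n : ℕ) : Continuous (dysonTerm 𝓛 s ρ n) := by
  induction n with
  | zero => exact continuous_const
  | succ n ih =>
    exact intervalIntegral.continuous_primitive (fun a b => (hc _ ih).intervalIntegrable a b) s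

theorem hasDerivAt_dysonTerm_succ
    (hc : ∀ X : ℝ → Op d, Continuous X → Continuous fun t => 𝓛 t (X t)) (ρ : Op d) (n : ℕ)
    (t : ℝ) : HasDerivAt (dysonTerm 𝓛 s ρ (n + 1)) (𝓛 t (dysonTerm 𝓛 s ρ n t)) t :=
  intervalIntegral.integral_hasDerivAt_right
    ((hc _ (continuous_dysonTerm hc ρ n)).intervalIntegrable _ _)
    ((hc _ (continuous_dysonTerm hc ρ n)).stronglyMeasurableAtFilter _ _)
    (hc _ (continuous_dysonTerm hc ρ n)).continuousAt

theorem norm_dysonTerm_le {M R : ℝ} (hM : 0 ≤ M)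
    (hb : ∀ t, |t - s| ≤ R → ∀ X : Op d, ‖𝓛 t X‖ ≤ M * ‖X‖) (ρ : Op d) (n : ℕ) :
    ∀ t, |t - s| ≤ R → ‖dysonTerm 𝓛 s ρ n t‖ ≤ ‖ρ‖ * ((M * |t - s|) ^ n / n.factorial) := by
  induction n with
  | zero => intro t _; simp [dysonTerm]
  | succ n ih =>
    intro t ht
    rw [dysonTerm]
    have h1 : ∀ u ∈ Set.uIoc s t, ‖𝓛 u (dysonTerm 𝓛 s ρ n u)‖ ≤
        M * (‖ρ‖ * (M ^ n / n.factorial)) * |u - s| ^ n := fun u hu => by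
      have hu' : |u - s| ≤ R :=
        (Set.abs_sub_left_of_mem_uIcc (Set.uIoc_subset_uIcc hu)).trans ht
      refine (hb u hu' _).trans ?_
      rw [mul_assoc M]
      refine mul_le_mul_of_nonneg_left ((ih u hu').trans_eq ?_) hM
      rw [mul_pow]; ring
    rw [intervalIntegral.norm_intervalIntegral_eq]
    refine (MeasureTheory.norm_integral_le_of_norm_le
      (g := fun u => M * (‖ρ‖ * (M ^ n / n.factorial)) * |u - s| ^ n) ?_ ?_).trans_eq ?_
    · exact intervalIntegrable_iff.1 (Continuous.intervalIntegrable (by fun_prop) _ _)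
    · exact (MeasureTheory.ae_restrict_iff' measurableSet_uIoc).2 (Eventually.of_forall h1)
    · rw [MeasureTheory.integral_const_mul, integral_pow_abs_sub_uIoc, Nat.factorial_succ]
      push_cast
      have : (n.factorial : ℝ) ≠ 0 := by positivity
      field_simp
      ring

theorem evolution_self (ρ : Op d) : evolution 𝓛 s s ρ = ρ := by
  rw [evolution, tsum_eq_single 0]
  · rfl
  · rintro (_ | n) hn
    · exact absurd rfl hn
    · simp [dysonTerm]

/-- Each term differentiates to the generator applied to the previous one, and the
exponential-series majorant is uniform on a ball around `s`, so the series may be differentiated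
termwise. -/
theorem hasDerivAt_evolution
    (hc : ∀ X : ℝ → Op d, Continuous X → Continuous fun t => 𝓛 t (X t))
    (hb : ∀ R, ∃ M, 0 ≤ M ∧ ∀ t, |t - s| ≤ R → ∀ X : Op d, ‖𝓛 t X‖ ≤ M * ‖X‖)
    (ρ : Op d) (t : ℝ) :
    HasDerivAt (fun t => evolution 𝓛 t s ρ) (𝓛 t (evolution 𝓛 t s ρ)) t := by
  -- The extra `1` puts `t` inside the open ball of radius `R` about `s`.
  set R := |t - s| + 1
  have hR : 0 < R := by positivity
  obtain ⟨M, hM, hMb⟩ := hb R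
  have hbound : ∀ n, ∀ y ∈ Metric.ball s R,
      ‖dysonTerm 𝓛 s ρ n y‖ ≤ ‖ρ‖ * ((M * R) ^ n / n.factorial) := fun n y hy => by
    have hy' : |y - s| ≤ R := (Metric.mem_ball.1 hy).le
    refine (norm_dysonTerm_le hM hMb ρ n y hy').trans ?_
    gcongr
  have hsum : Summable fun n : ℕ => ‖ρ‖ * ((M * R) ^ n / n.factorial) :=
    (Real.summable_pow_div_factorial _).mul_left _
  have hts : t ∈ Metric.ball s R := by
    rw [Metric.mem_ball, Real.dist_eq]; exact lt_add_one _
  have hsumm : ∀ y ∈ Metric.ball s R, Summable fun n => dysonTerm 𝓛 s ρ n y := fun y hy =>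
    Summable.of_norm_bounded hsum fun n => hbound n y hy
  let g' : ℕ → ℝ → Op d := fun n y => 𝓛 y (dysonTerm 𝓛 s ρ n y)
  have hderiv := hasDerivAt_tsum_of_isPreconnected (g := fun n => dysonTerm 𝓛 s ρ (n + 1))
    (g' := g') (hsum.mul_left M) Metric.isOpen_ball (convex_ball s R).isPreconnected
    (fun n y _ => hasDerivAt_dysonTerm_succ hc ρ n y)
    (fun n y hy => (hMb y (Metric.mem_ball.1 hy).le _).trans
      (mul_le_mul_of_nonneg_left (hbound n y hy) hM))
    hts ((summable_nat_add_iff 1).2 (hsumm t hts)) hts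
  have h1 : ∑' n, g' n t = 𝓛 t (evolution 𝓛 t s ρ) :=
    ((LinearMap.toContinuousLinearMap (𝓛 t)).map_tsum (hsumm t hts)).symm
  rw [h1] at hderiv
  refine (hderiv.const_add ρ).congr_of_eventuallyEq ?_
  filter_upwards [Metric.isOpen_ball.mem_nhds hts] with y hy
  rw [evolution, (hsumm y hy).tsum_eq_zero_add]
  rfl

theorem dysonTerm_congr {𝓛' : ℝ → Op d →ₗ[ℂ] Op d} (h : ∀ t, s ≤ t → 𝓛 t = 𝓛' t) (ρ : Op d)
    (n : ℕ) : ∀ t, s ≤ t → dysonTerm 𝓛 s ρ n t = dysonTerm 𝓛' s ρ n t := by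
  induction n with
  | zero => intro t _; rfl
  | succ n ih =>
    intro t ht
    refine intervalIntegral.integral_congr fun u hu => ?_
    rw [Set.uIcc_of_le ht] at hu
    simp only [ih u hu.1, h u hu.1]

theorem evolution_congr {𝓛' : ℝ → Op d →ₗ[ℂ] Op d} (h : ∀ t, s ≤ t → 𝓛 t = 𝓛' t) (ρ : Op d)
    {t : ℝ} (ht : s ≤ t) : evolution 𝓛 t s ρ = evolution 𝓛' t s ρ :=
  tsum_congr fun n => dysonTerm_congr h ρ n t ht

end Dyson

theorem exists_norm_lindbladian_le {d m : ℕ} (L : Fin m → Op d) :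
    ∃ C, 0 ≤ C ∧ ∀ H X : Op d, ‖lindbladian L H X‖ ≤ (2 * ‖H‖ + C) * ‖X‖ := by
  let D := LinearMap.toContinuousLinearMap (∑ i, dissipator (L i))
  refine ⟨‖D‖, norm_nonneg _, fun H X => ?_⟩
  have h1 : ‖hamiltonianPart H X‖ ≤ 2 * ‖H‖ * ‖X‖ := by
    simp only [hamiltonianPart, LinearMap.coe_mk, AddHom.coe_mk, norm_smul, norm_neg,
      Complex.norm_I, one_mul]
    have := norm_sub_le (H * X) (X * H)
    have := norm_mul_le H X
    have := norm_mul_le X H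
    nlinarith
  rw [lindbladian, add_mul]
  exact (norm_add_le _ _).trans (add_le_add h1 (D.le_opNorm X))

theorem isSolution_evolution_of_continuous {d m : ℕ} (L : Fin m → Op d) {H : ℝ → Op d}
    (hH : Continuous H) (s : ℝ) (ρ : Op d) :
    IsSolution L H s (fun t => evolution (fun t => lindbladian L (H t)) t s ρ) := by
  refine fun t _ => (hasDerivAt_evolution (fun X hX => ?_) (fun R => ?_) ρ t).hasDerivWithinAt
  · have h2 : Continuous fun t => (∑ i, dissipator (L i)) (X t) :=
      (LinearMap.continuous_of_finiteDimensional _).comp hX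
    have h1 : Continuous fun t => hamiltonianPart (H t) (X t) := by
      simp only [hamiltonianPart, LinearMap.coe_mk, AddHom.coe_mk]
      fun_prop
    exact h1.add h2
  · obtain ⟨C, hC, hb⟩ := exists_norm_lindbladian_le L
    obtain ⟨M, hM⟩ := (isCompact_closedBall s R).exists_bound_of_continuousOn hH.continuousOn
    refine ⟨2 * |M| + C, by positivity, fun t ht X => (hb (H t) X).trans ?_⟩
    have := (hM t ht).trans (le_abs_self M)
    gcongr

/-- `H` is controlled only on `[0, ∞)`, so it is replaced by the continuous extension `H (max t 0)`;
for `t ≥ s ≥ 0` the Dyson terms see only times in `[s, t]`, where the two agree. -/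
theorem isSolution_evolution {d m : ℕ} (L : Fin m → Op d) {H : ℝ → Op d}
    (hH : ContinuousOn H (Set.Ici 0)) {s : ℝ} (hs : 0 ≤ s) (ρ : Op d) :
    IsSolution L H s (fun t => evolution (fun t => lindbladian L (H t)) t s ρ) := by
  have hH' : Continuous fun t => H (max t 0) :=
    hH.comp_continuous (by fun_prop) fun t => le_max_right t 0
  have heq : ∀ t, s ≤ t → H (max t 0) = H t := fun t ht => by rw [max_eq_left (hs.trans ht)]
  have hev : ∀ t, s ≤ t → evolution (fun t => lindbladian L (H t)) t s ρ =
      evolution (fun t => lindbladian L (H (max t 0))) t s ρ := fun t ht =>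
    evolution_congr (fun u hu => by rw [heq u hu]) ρ ht
  intro t ht
  have h := isSolution_evolution_of_continuous L hH' s ρ t ht
  simp only [heq t ht, ← hev t ht] at h
  exact h.congr (fun u hu => hev u hu) (hev t ht)

/-! ### From differences of states to traceless Hermitian operators. -/

section MatrixOrder

open scoped MatrixOrder

theorem posSemidef_add_norm_smul_one {d : ℕ} {Z : Op d} (hZ : Z.IsHermitian) :
    (Z + (‖Z‖ : ℂ) • (1 : Op d)).PosSemidef := by
  have h := IsSelfAdjoint.neg_algebraMap_norm_le_self (a := Z) hZ
  rw [Matrix.le_iff, sub_neg_eq_add, IsScalarTower.algebraMap_apply ℝ ℂ (Op d),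
    Algebra.algebraMap_eq_smul_one] at h
  exact h

end MatrixOrder

/-- Traceless Hermitian operators are multiples of differences of states. -/
theorem exists_isState_sub_isState {d : ℕ} (hd : d ≠ 0) {Z : Op d} (hZ : Z.IsHermitian)
    (htr : Z.trace = 0) :
    ∃ ρ σ : Op d, IsState ρ ∧ IsState σ ∧ ∃ c : ℝ, 0 ≤ c ∧ Z = c • (ρ - σ) := by
  have hd0 : (0 : ℝ) < d := by exact_mod_cast Nat.pos_of_ne_zero hd
  have hdC : (d : ℂ) ≠ 0 := by exact_mod_cast hd
  -- The added `1` keeps `N` invertible even when `Z = 0`. The states are `(Z + N)/(dN)` and the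
  -- maximally mixed `1/d`.
  set N : ℝ := ‖Z‖ + 1 with hN
  have hN0 : 0 < N := by positivity
  have hNC : (N : ℂ) ≠ 0 := by exact_mod_cast hN0.ne'
  have h1 : (1 : Op d).PosSemidef := PosSemidef.one
  have h2 : (Z + (N : ℂ) • (1 : Op d)).PosSemidef := by
    have := (posSemidef_add_norm_smul_one hZ).add h1
    rw [add_assoc] at this
    convert! this using 2
    rw [hN]; push_cast; module
  have e1 : (0 : ℂ) ≤ ((d * N)⁻¹ : ℝ) := by exact_mod_cast (by positivity : (0 : ℝ) ≤ (d * N)⁻¹)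
  have e2 : (0 : ℂ) ≤ ((d : ℝ)⁻¹ : ℝ) := by exact_mod_cast (by positivity : (0 : ℝ) ≤ (d : ℝ)⁻¹)
  refine ⟨(((d * N)⁻¹ : ℝ) : ℂ) • (Z + (N : ℂ) • (1 : Op d)), (((d : ℝ)⁻¹ : ℝ) : ℂ) • (1 : Op d),
    ⟨h2.smul e1, ?_⟩, ⟨h1.smul e2, ?_⟩, d * N, by positivity, ?_⟩
  · rw [trace_smul, trace_add, trace_smul, htr, trace_one, Fintype.card_fin]
    push_cast
    simp only [smul_eq_mul]
    field_simp
    simp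
  · rw [trace_smul, trace_one, Fintype.card_fin]
    push_cast
    simp only [smul_eq_mul]
    field_simp
  · rw [← Complex.coe_smul]
    push_cast
    rw [smul_sub, smul_smul, smul_smul, mul_inv_cancel₀ (mul_ne_zero hdC hNC), one_smul,
      show (d : ℂ) * N * (d : ℂ)⁻¹ = N by field_simp]
    simp

theorem IsSolution.traceNorm_le_of_isContractiveWith {d m : ℕ} (hd : d ≠ 0) {L : Fin m → Op d}
    {H : Op d} (hH : H.IsHermitian) {K γ : ℝ}
    (hfrozen : IsContractiveWith (fun _ => lindbladian L H) K γ) {s : ℝ} (hs : 0 ≤ s)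
    {Y : ℝ → Op d} (hY : IsSolution L (fun _ => H) s Y) (hherm : (Y s).IsHermitian)
    (htr : (Y s).trace = 0) {t : ℝ} (ht : s ≤ t) :
    traceNorm (Y t) ≤ K * Real.exp (-γ * (t - s)) * traceNorm (Y s) := by
  obtain ⟨ρ, σ, hρ, hσ, c, hc, hZ⟩ := exists_isState_sub_isState hd hherm htr
  have hW := (isSolution_evolution L (H := fun _ => H) continuousOn_const hs (ρ - σ)).smul c
  have h1 : Y t = c • evolution (fun _ => lindbladian L H) t s (ρ - σ) :=
    hY.eq_of_eq hW (fun _ _ => hH) (by simp [evolution_self, hZ]) ht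
  have hcC : ‖(c : ℂ)‖ = c := by rw [Complex.norm_real, Real.norm_of_nonneg hc]
  have h2 := hfrozen ρ σ hρ hσ s t hs ht
  rw [abs_of_nonneg (sub_nonneg.2 ht)] at h2
  rw [h1, hZ, ← Complex.coe_smul, ← Complex.coe_smul, traceNorm_smul, traceNorm_smul, hcC]
  calc _ ≤ c * _ := mul_le_mul_of_nonneg_left h2 hc
    _ = _ := by ring

/-! ### Deviation of the driven evolution from a frozen one. -/

theorem lindbladian_sub_lindbladian {d m : ℕ} (L : Fin m → Op d) (H H' X : Op d) :
    lindbladian L H X - lindbladian L H' X = (-Complex.I) • ((H - H') * X - X * (H - H')) := by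
  simp only [lindbladian, hamiltonianPart, LinearMap.add_apply, LinearMap.coe_mk, AddHom.coe_mk]
  rw [add_sub_add_right_eq_sub, ← smul_sub, sub_mul, mul_sub]
  congr 1
  abel

theorem traceNorm_lindbladian_sub_le {d m : ℕ} (L : Fin m → Op d) (H H' X : Op d) :
    traceNorm (lindbladian L H X - lindbladian L H' X) ≤ 2 * ‖H - H'‖ * traceNorm X := by
  rw [lindbladian_sub_lindbladian, traceNorm_smul, norm_neg, Complex.norm_I, one_mul]
  have h1 := traceNorm_sub_le ((H - H') * X) (X * (H - H'))
  have h2 := traceNorm_mul_le_left (H - H') X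
  have h3 := traceNorm_mul_le_right (H - H') X
  linarith

/-- Comparison of the driven evolution with a frozen one. -/
theorem traceNorm_sub_le_of_frozen {d m : ℕ} {L : Fin m → Op d} {H : ℝ → Op d} {H₀ : Op d}
    {s : ℝ} {X Y : ℝ → Op d} (hX : IsSolution L H s X) (hY : IsSolution L (fun _ => H₀) s Y)
    (hH : ∀ t, s ≤ t → (H t).IsHermitian) {B B' : ℝ → ℝ} {p q : ℝ} (hp : s ≤ p) (hpq : p ≤ q)
    (hB : ∀ t, HasDerivAt B (B' t) t)
    (hR : ∀ t, p ≤ t → t ≤ q → 2 * ‖H t - H₀‖ * traceNorm (Y t) ≤ B' t) :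
    traceNorm (X q - Y q) ≤ traceNorm (X p - Y p) + (B q - B p) := by
  refine traceNorm_le_of_hasDerivWithinAt L (H := H) (X := X - Y)
    (R := fun t => lindbladian L (H t) (Y t) - lindbladian L H₀ (Y t)) hpq
    (fun t ht => hH t (hp.trans ht.1)) ((hX.continuousOn p q hp).sub (hY.continuousOn p q hp))
    (fun t ht => ?_) (fun t _ => (hB t).continuousAt.continuousWithinAt)
    (fun t _ => (hB t).hasDerivWithinAt)
    (fun t ht => (traceNorm_lindbladian_sub_le L _ _ _).trans (hR t ht.1 ht.2.le))
  have h := (hX.hasDerivWithinAt_Ici (hp.trans ht.1)).sub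
    (hY.hasDerivWithinAt_Ici (hp.trans ht.1))
  convert! h using 1
  simp

/-- The product `(1 + x + x²/2)(1 - x + x²/2)` equals `1 + x⁴/4`, hence is at least one. -/
theorem exp_neg_le_quadratic {x : ℝ} (hx : 0 ≤ x) : Real.exp (-x) ≤ 1 - x + x ^ 2 / 2 := by
  have h := Real.quadratic_le_exp_of_nonneg hx
  have hpos : 0 < 1 + x + x ^ 2 / 2 := by positivity
  rw [Real.exp_neg]
  refine (inv_anti₀ hpos h).trans ?_
  rw [inv_le_iff_one_le_mul₀ hpos]
  nlinarith [sq_nonneg (x ^ 2)]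

/-- The accumulated deviation from the evolution frozen at the intermediate time
`s + (log K + 1) / (2 γ)`. -/
theorem traceNorm_sub_le_of_lipschitz {d m : ℕ} {L : Fin m → Op d} {H : ℝ → Op d}
    {s c K γ a T N : ℝ} {X Y : ℝ → Op d} (hγ : 0 < γ) (hK : 1 ≤ K) (hc : 0 ≤ c) (hN : 0 ≤ N)
    (ha : a = (Real.log K + 1) / (2 * γ))
    (hX : IsSolution L H s X) (hY : IsSolution L (fun _ => H (s + a)) s Y) (hXY : X s = Y s)
    (hH : ∀ t, s ≤ t → (H t).IsHermitian)
    (hlip : ∀ t, s ≤ t → ‖H t - H (s + a)‖ ≤ c * |t - (s + a)|)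
    (hY1 : ∀ t, s ≤ t → traceNorm (Y t) ≤ N)
    (hY2 : ∀ t, s ≤ t → traceNorm (Y t) ≤ K * Real.exp (-γ * (t - s)) * N)
    (haT : a ≤ T) (hlT : Real.log K / γ ≤ T) :
    traceNorm (X (s + T) - Y (s + T)) ≤
      c * (Real.log K ^ 2 + 2 * Real.log K + 3) / (2 * γ ^ 2) * N := by
  have hl : 0 ≤ Real.log K := Real.log_nonneg hK
  have hKl : K = Real.exp (Real.log K) := (Real.exp_log (by linarith)).symm
  set l := Real.log K
  have ha0 : 0 ≤ a := by rw [ha]; positivity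
  have hγa : γ * a = (l + 1) / 2 := by rw [ha]; field_simp
  -- `B₁`, `B₂` and `B₃` are antiderivatives of the forcing bound: before the freezing time, after
  -- it with `‖Y‖₁ ≤ N`, and after it with the decaying bound.
  let B₁ : ℝ → ℝ := fun t => 2 * c * N * (a * (t - s) - (t - s) ^ 2 / 2)
  have hB₁ : ∀ t, HasDerivAt B₁ (2 * c * N * (a - (t - s))) t := fun t => by
    have h0 : HasDerivAt (fun t => t - s) 1 t := (hasDerivAt_id t).sub_const s
    convert! ((h0.const_mul a).sub ((h0.pow 2).div_const 2)).const_mul (2 * c * N) using 1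
    ring
  let B₂ : ℝ → ℝ := fun t => c * N * (t - s - a) ^ 2
  have hB₂ : ∀ t, HasDerivAt B₂ (2 * c * N * (t - s - a)) t := fun t => by
    have h0 : HasDerivAt (fun t => t - s - a) 1 t := ((hasDerivAt_id t).sub_const s).sub_const a
    convert! (h0.pow 2).const_mul (c * N) using 1
    ring
  let B₃ : ℝ → ℝ := fun t =>
    -(2 * c * N * K) * (Real.exp (-γ * (t - s)) * ((t - s - a) / γ + 1 / γ ^ 2))
  have hB₃ : ∀ t, HasDerivAt B₃ (2 * c * N * (t - s - a) * (K * Real.exp (-γ * (t - s)))) t :=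
    fun t => by
    have h0 : HasDerivAt (fun t => t - s - a) 1 t := ((hasDerivAt_id t).sub_const s).sub_const a
    have h1 : HasDerivAt (fun t => -γ * (t - s)) (-γ * 1) t :=
      ((hasDerivAt_id t).sub_const s).const_mul (-γ)
    convert! (h1.exp.mul ((h0.div_const γ).add_const (1 / γ ^ 2))).const_mul
      (-(2 * c * N * K)) using 1
    field_simp
    ring
  have hstage₁ : traceNorm (X (s + a) - Y (s + a)) ≤ c * N * a ^ 2 := by
    have h := traceNorm_sub_le_of_frozen hX hY hH le_rfl (le_add_of_nonneg_right ha0) hB₁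
      (fun t ht1 ht2 => by
        have h1 := hlip t ht1
        rw [abs_of_nonpos (by linarith)] at h1
        calc 2 * ‖H t - H (s + a)‖ * traceNorm (Y t) ≤ 2 * (c * -(t - (s + a))) * N :=
              mul_le_mul (by linarith) (hY1 t ht1) (traceNorm_nonneg _)
                (by linarith [norm_nonneg (H t - H (s + a))])
          _ = _ := by ring)
    rw [hXY, sub_self, traceNorm_zero] at h
    refine h.trans_eq ?_
    simp only [B₁]
    ring
  have hstage₃ : ∀ r, a ≤ r → r ≤ T → traceNorm (X (s + T) - Y (s + T)) ≤
      traceNorm (X (s + r) - Y (s + r)) +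
        2 * c * N * (K * Real.exp (-γ * r)) * ((r - a) / γ + 1 / γ ^ 2) := fun r har hrT => by
    have h := traceNorm_sub_le_of_frozen hX hY hH (p := s + r) (q := s + T) (by linarith)
      (by linarith) hB₃ (fun t ht1 ht2 => by
        have h1 := hlip t (by linarith)
        rw [abs_of_nonneg (by linarith)] at h1
        calc 2 * ‖H t - H (s + a)‖ * traceNorm (Y t) ≤
              2 * (c * (t - (s + a))) * (K * Real.exp (-γ * (t - s)) * N) :=
              mul_le_mul (by linarith) (hY2 t (by linarith)) (traceNorm_nonneg _)
                (by linarith [norm_nonneg (H t - H (s + a))])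
          _ = _ := by ring)
    -- `B₃` vanishes at infinity and is nonpositive from `s + a` on, so dropping its value at `s +
    -- T` bounds the tail uniformly in `T`.
    have h2 : B₃ (s + T) ≤ 0 := by
      have : 0 ≤ s + T - s - a := by linarith
      simp only [B₃, neg_mul]
      exact neg_nonpos.2 (by positivity)
    have h3 : -B₃ (s + r) = 2 * c * N * (K * Real.exp (-γ * r)) * ((r - a) / γ + 1 / γ ^ 2) := by
      simp only [B₃, add_sub_cancel_left]
      ring
    linarith
  -- The two bounds on `‖Y‖₁` cross at time `l/γ` after `s`, which is at least `a` exactly when `l ≥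
  -- 1`. Otherwise the decaying bound is used from `a` on, and the quadratic bound on `K e^{-γa} =
  -- e^{-(1-l)/2}` yields the same polynomial in `l`.
  rcases le_total 1 l with h1l | hl1
  · have hal : a ≤ l / γ := by
      rw [ha, div_le_div_iff₀ (by positivity) hγ]; nlinarith
    have h := traceNorm_sub_le_of_frozen hX hY hH (p := s + a) (q := s + l / γ) (by linarith)
      (by linarith) hB₂ (fun t ht1 ht2 => by
        have h1 := hlip t (by linarith)
        rw [abs_of_nonneg (by linarith)] at h1
        calc 2 * ‖H t - H (s + a)‖ * traceNorm (Y t) ≤ 2 * (c * (t - (s + a))) * N :=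
              mul_le_mul (by linarith) (hY1 t (by linarith)) (traceNorm_nonneg _)
                (by linarith [norm_nonneg (H t - H (s + a))])
          _ = _ := by ring)
    have h3 := hstage₃ (l / γ) hal hlT
    have hexp : K * Real.exp (-γ * (l / γ)) = 1 := by
      rw [show -γ * (l / γ) = -l by field_simp, hKl, ← Real.exp_add, add_neg_cancel, Real.exp_zero]
    rw [hexp] at h3
    refine (h3.trans (add_le_add_left (h.trans (add_le_add_left hstage₁ _)) _)).trans_eq ?_
    simp only [B₂]
    rw [ha]
    field_simp
    ring
  · have h3 := hstage₃ a le_rfl haT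
    have hexp : K * Real.exp (-γ * a) ≤ 1 - (1 - l) / 2 + ((1 - l) / 2) ^ 2 / 2 := by
      rw [hKl, ← Real.exp_add, show l + -γ * a = -((1 - l) / 2) by linarith]
      exact exp_neg_le_quadratic (by linarith)
    refine (h3.trans (add_le_add hstage₁ (mul_le_mul_of_nonneg_right
      (mul_le_mul_of_nonneg_left hexp (by positivity)) ?_))).trans_eq ?_
    · rw [sub_self]; positivity
    · rw [ha]
      field_simp
      ring

/-! ### Iterating the contraction over windows. -/

/-- Uniform contraction over a fixed time step, together with monotonicity, gives exponential
decay. -/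
theorem le_exp_of_step {f : ℝ → ℝ} {s T q : ℝ} (hT : 0 < T) (hq : 0 < q) (hq1 : q < 1)
    (hf : ∀ p t, s ≤ p → p ≤ t → f t ≤ f p) (hfs : 0 ≤ f s)
    (hstep : ∀ p, s ≤ p → f (p + T) ≤ q * f p) {t : ℝ} (ht : s ≤ t) :
    f t ≤ q⁻¹ * Real.exp (-(-Real.log q / T) * (t - s)) * f s := by
  have hn : ∀ n : ℕ, f (s + n * T) ≤ q ^ n * f s := fun n => by
    induction n with
    | zero => simp
    | succ n ih =>
      have h := hstep (s + n * T) (le_add_of_nonneg_right (by positivity))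
      rw [show s + n * T + T = s + ((n + 1 : ℕ) : ℝ) * T by push_cast; ring] at h
      refine h.trans ((mul_le_mul_of_nonneg_left ih hq.le).trans_eq ?_)
      ring
  have hts : 0 ≤ (t - s) / T := div_nonneg (sub_nonneg.2 ht) hT.le
  -- Only complete windows contract; the prefactor `q⁻¹` pays for the incomplete last one.
  set n := ⌊(t - s) / T⌋₊
  have h1 : (n : ℝ) * T ≤ t - s := (le_div_iff₀ hT).1 (Nat.floor_le hts)
  have h2 : (t - s) / T < n + 1 := Nat.lt_floor_add_one _
  refine (hf (s + n * T) t (le_add_of_nonneg_right (by positivity)) (by linarith)).trans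
    ((hn n).trans (mul_le_mul_of_nonneg_right ?_ hfs))
  have hlog : Real.log q < 0 := Real.log_neg hq hq1
  have h3 : q ^ n = Real.exp (Real.log q * n) := by
    rw [mul_comm, Real.exp_nat_mul, Real.exp_log hq]
  have h4 : q⁻¹ = Real.exp (-Real.log q) := by rw [Real.exp_neg, Real.exp_log hq]
  rw [h3, h4, ← Real.exp_add, Real.exp_le_exp]
  have h5 : -(-Real.log q / T) * (t - s) = Real.log q * ((t - s) / T) := by ring
  rw [h5]
  nlinarith

/-- At `t = s` the evolution is the identity, so `K < 1` forces every difference of states to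
vanish. This degenerate case must be split off because the main estimate uses `log K ≥ 0`. -/
theorem isContractiveWith_one_of_lt_one {d m : ℕ} {L : Fin m → Op d} {H : ℝ → Op d}
    (hH : ∀ t, 0 ≤ t → (H t).IsHermitian) (hHc : ContinuousOn H (Set.Ici 0)) {K γ : ℝ}
    (hK : K < 1)
    (hfrozen : IsContractiveWith (fun _ => lindbladian L (H 0)) K γ) :
    IsContractiveWith (fun t => lindbladian L (H t)) 1 1 := by
  intro ρ σ hρ hσ s t hs hst
  have h0 := hfrozen ρ σ hρ hσ 0 0 le_rfl le_rfl
  rw [evolution_self, sub_self, abs_zero, mul_zero, Real.exp_zero, mul_one] at h0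
  have h1 : traceNorm (ρ - σ) = 0 := by nlinarith [traceNorm_nonneg (ρ - σ)]
  have h2 := (isSolution_evolution L hHc hs (ρ - σ)).traceNorm_le
    (fun u hu => hH u (hs.trans hu)) hst
  rw [evolution_self, h1] at h2
  rw [h1, mul_zero]
  exact h2

/-- Contraction of a traceless Hermitian solution over a sufficiently long time step. -/
theorem IsSolution.traceNorm_add_le {d m : ℕ} (hd : d ≠ 0) {L : Fin m → Op d} {H : ℝ → Op d}
    (hH : ∀ t, 0 ≤ t → (H t).IsHermitian) {c K γ T : ℝ}
    (hc : 0 ≤ c) (hlip : ∀ t t', 0 ≤ t → 0 ≤ t' → ‖H t - H t'‖ ≤ c * |t - t'|)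
    (hK : 1 ≤ K) (hγ : 0 < γ)
    (hfrozen : ∀ t₀, 0 ≤ t₀ → IsContractiveWith (fun _ => lindbladian L (H t₀)) K γ)
    (hTa : (Real.log K + 1) / (2 * γ) ≤ T) (hTl : Real.log K / γ ≤ T) {p : ℝ} (hp : 0 ≤ p)
    {X : ℝ → Op d} (hX : IsSolution L H p X) (hherm : (X p).IsHermitian)
    (htr : (X p).trace = 0) :
    traceNorm (X (p + T)) ≤ (K * Real.exp (-γ * T) +
      c * (Real.log K ^ 2 + 2 * Real.log K + 3) / (2 * γ ^ 2)) * traceNorm (X p) := by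
  obtain ⟨a, ha⟩ : ∃ a, a = (Real.log K + 1) / (2 * γ) := ⟨_, rfl⟩
  rw [← ha] at hTa
  have ha0 : 0 ≤ a := by
    have := Real.log_nonneg hK
    rw [ha]; positivity
  have hpa : 0 ≤ p + a := add_nonneg hp ha0
  obtain ⟨Y, hY, hYp⟩ : ∃ Y, IsSolution L (fun _ => H (p + a)) p Y ∧ Y p = X p :=
    ⟨_, isSolution_evolution L (H := fun _ => H (p + a)) continuousOn_const hp (X p),
      evolution_self _⟩
  have hY1 : ∀ u, p ≤ u → traceNorm (Y u) ≤ traceNorm (X p) := fun u hu => by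
    rw [← hYp]; exact hY.traceNorm_le (fun _ _ => hH _ hpa) hu
  have hY2 : ∀ u, p ≤ u → traceNorm (Y u) ≤ K * Real.exp (-γ * (u - p)) * traceNorm (X p) :=
    fun u hu => by
    have := hY.traceNorm_le_of_isContractiveWith hd (hH _ hpa) (hfrozen _ hpa) hp
      (by rwa [hYp]) (by rwa [hYp]) hu
    rwa [hYp] at this
  have h1 := traceNorm_sub_le_of_lipschitz hγ hK hc (traceNorm_nonneg (X p)) ha hX hY
    hYp.symm (fun u hu => hH u (hp.trans hu)) (fun u hu => hlip u _ (hp.trans hu) hpa)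
    hY1 hY2 hTa hTl
  have hpT : p ≤ p + T := by linarith
  have h2 := hY2 (p + T) hpT
  rw [add_sub_cancel_left] at h2
  have h3 := DrivenLindblad.traceNorm_add_le (X (p + T) - Y (p + T)) (Y (p + T))
  rw [sub_add_cancel] at h3
  rw [add_mul]
  linarith

theorem exists_contracting_step {K γ θ b : ℝ} (hγ : 0 < γ) (hθ : θ < 1) :
    ∃ T, K * Real.exp (-γ * T) + θ < 1 ∧ b ≤ T ∧ 0 < T := by
  have hlim : Tendsto (fun T => K * Real.exp (-γ * T) + θ) atTop (𝓝 (K * 0 + θ)) :=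
    ((Real.tendsto_exp_atBot.comp
      (tendsto_id.const_mul_atTop_of_neg (neg_neg_of_pos hγ))).const_mul K).add_const θ
  rw [mul_zero, zero_add] at hlim
  exact ((hlim.eventually_lt_const hθ).and ((eventually_ge_atTop b).and
    (eventually_gt_atTop 0))).exists

theorem isExponentiallyContractive_of_lipschitz {d m : ℕ} {L : Fin m → Op d} {H : ℝ → Op d}
    (hH : ∀ t, 0 ≤ t → (H t).IsHermitian) (hHc : ContinuousOn H (Set.Ici 0)) {c K γ : ℝ}
    (hc : 0 ≤ c) (hlip : ∀ t t', 0 ≤ t → 0 ≤ t' → ‖H t - H t'‖ ≤ c * |t - t'|)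
    (hK : 1 ≤ K) (hγ : 0 < γ)
    (hfrozen : ∀ t₀, 0 ≤ t₀ → IsContractiveWith (fun _ => lindbladian L (H t₀)) K γ)
    (hslow : c * (Real.log K ^ 2 + 2 * Real.log K + 3) / (2 * γ ^ 2) < 1) :
    IsExponentiallyContractive (fun t => lindbladian L (H t)) := by
  have hl : 0 ≤ Real.log K := Real.log_nonneg hK
  have hθ : 0 ≤ c * (Real.log K ^ 2 + 2 * Real.log K + 3) / (2 * γ ^ 2) := by positivity
  obtain ⟨T, hTq, hTb, hT⟩ := exists_contracting_step (K := K)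
    (b := max ((Real.log K + 1) / (2 * γ)) (Real.log K / γ)) hγ hslow
  obtain ⟨q, hq⟩ : ∃ q, q = K * Real.exp (-γ * T) +
    c * (Real.log K ^ 2 + 2 * Real.log K + 3) / (2 * γ ^ 2) := ⟨_, rfl⟩
  have hq0 : 0 < q := hq ▸ by positivity
  rw [← hq] at hTq
  refine ⟨q⁻¹, -Real.log q / T, by positivity,
    div_pos (neg_pos.2 (Real.log_neg hq0 hTq)) hT, fun ρ σ hρ hσ s t hs hst => ?_⟩
  -- In dimension zero every trace vanishes, so no states exist.
  have hd : d ≠ 0 := by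
    rintro rfl
    have := hρ.2
    simp at this
  obtain ⟨X, hX, hXs, hXt⟩ : ∃ X, IsSolution L H s X ∧ X s = ρ - σ ∧
      X t = evolution (fun t => lindbladian L (H t)) t s (ρ - σ) :=
    ⟨_, isSolution_evolution L hHc hs (ρ - σ), evolution_self _, rfl⟩
  have hHs : ∀ u, s ≤ u → (H u).IsHermitian := fun u hu => hH u (hs.trans hu)
  have hherm : ∀ u, s ≤ u → (X u).IsHermitian := fun u hu =>
    hX.isHermitian hHs (by rw [hXs]; exact hρ.1.1.sub hσ.1.1) hu
  have htr : ∀ u, s ≤ u → (X u).trace = 0 := fun u hu => by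
    rw [hX.trace_eq hu, hXs, trace_sub, hρ.2, hσ.2, sub_self]
  rw [abs_of_nonneg (sub_nonneg.2 hst), ← hXt, ← hXs]
  refine le_exp_of_step (f := fun u => traceNorm (X u)) hT hq0 hTq
    (fun p u hp hpu => (hX.mono hp).traceNorm_le (fun v hv => hHs v (hp.trans hv)) hpu)
    (traceNorm_nonneg _) (fun p hp => ?_) hst
  rw [hq]
  exact (hX.mono hp).traceNorm_add_le hd hH hc hlip hK hγ hfrozen ((le_max_left _ _).trans hTb)
    ((le_max_right _ _).trans hTb) (hs.trans hp) (hherm p hp) (htr p hp)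

/-- The threshold equals `2γ²/(l² + 2l + 3)`, whose denominator `(l + 1)² + 2` is positive for every
real `l`. -/
theorem mul_div_lt_one_of_lt {c γ l : ℝ} (hγ : 0 < γ)
    (h : c < 2 * γ ^ 2 / 3 * (1 / (1 + 2 / 3 * l + 1 / 3 * l ^ 2))) :
    c * (l ^ 2 + 2 * l + 3) / (2 * γ ^ 2) < 1 := by
  have h1 : 0 < 1 + 2 / 3 * l + 1 / 3 * l ^ 2 := by nlinarith [sq_nonneg (l + 1)]
  rw [mul_one_div, lt_div_iff₀ h1] at h
  rw [div_lt_one (by positivity)]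
  linarith

end DrivenLindblad

end
theorem mainTheorem2 {d m : ℕ}
    (L : Fin m → DrivenLindblad.Op d)
    (H : ℝ → DrivenLindblad.Op d)
    (hHherm : ∀ t : ℝ, 0 ≤ t → (H t).IsHermitian)
    (hHdiff : DifferentiableOn ℝ H (Set.Ici 0))
    (K₀ γ₀ : ℝ) (hK₀ : 0 < K₀) (hγ₀ : 0 < γ₀)
    (hfrozen : ∀ t₀ : ℝ, 0 ≤ t₀ →
      DrivenLindblad.IsContractiveWith (fun _ => DrivenLindblad.lindbladian L (H t₀)) K₀ γ₀)
    (hslow : (⨆ t ∈ Set.Ici (0 : ℝ), ‖derivWithin H (Set.Ici 0) t‖ₑ) <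
      ENNReal.ofReal (2 * γ₀ ^ 2 / 3 *
        (1 / (1 + 2 / 3 * Real.log K₀ + 1 / 3 * Real.log K₀ ^ 2)))) :
    DrivenLindblad.IsExponentiallyContractive (fun t => DrivenLindblad.lindbladian L (H t)) := by
  have hHc : ContinuousOn H (Set.Ici 0) := hHdiff.continuousOn
  rcases lt_or_ge K₀ 1 with hK | hK
  · exact ⟨1, 1, one_pos, one_pos,
      DrivenLindblad.isContractiveWith_one_of_lt_one hHherm hHc hK (hfrozen 0 le_rfl)⟩
  -- The supremum is taken in `ℝ≥0∞`, so the strict bound itself forces it to be finite; its real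
  -- value is then a Lipschitz constant by the mean value inequality.
  set S := ⨆ t ∈ Set.Ici (0 : ℝ), ‖derivWithin H (Set.Ici 0) t‖ₑ
  have hS : S ≠ ⊤ := hslow.ne_top
  have hderiv : ∀ t ∈ Set.Ici (0 : ℝ), ‖derivWithin H (Set.Ici 0) t‖ ≤ S.toReal := fun t ht => by
    rw [← toReal_enorm]
    exact ENNReal.toReal_mono hS
      (le_iSup₂ (f := fun (t : ℝ) (_ : t ∈ Set.Ici 0) => ‖derivWithin H (Set.Ici 0) t‖ₑ) t ht)
  refine DrivenLindblad.isExponentiallyContractive_of_lipschitz hHherm hHc ENNReal.toReal_nonneg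
    (fun t t' ht ht' => ?_) hK hγ₀ hfrozen
    (DrivenLindblad.mul_div_lt_one_of_lt hγ₀ (ENNReal.toReal_lt_of_lt_ofReal hslow))
  exact (convex_Ici 0).norm_image_sub_le_of_norm_derivWithin_le hHdiff hderiv ht' ht
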